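/- Let $k$ be an algebraically closed field, and let $X\subset\mathbf P^n_k$, $Y\subset\mathbf P^m_k$, $Z\subset\mathbf P^s_k$ be irreducible projective varieties with homogeneous prime ideals $\mathfrak a\subset k[\mathbf x]=k[x_0,\dots,x_n]$, $\mathfrak b\subset k[\mathbf y]=k[y_0,\dots,y_m]$, $\mathfrak c\subset k[\mathbf z]=k[z_0,\dots,z_s]$; assume that $X$ and $Y$ are non-degenerate (contained in no hyperplane). Put $R=k[\mathbf x,\mathbf y]/(\mathfrak a,\mathfrak b)$ and $S=k[\mathbf z]/\mathfrak c$. Let $\mathcal F:X\times Y\dashrightarrow Z$ be a rational map given by bihomogeneous polynomials $f_0,\dots,f_s$ of the same bidegree, not all zero in $R$. One says that $\mathcal F$ is *birational with image $Z$* if it is dominant and has an inverse rational map $Z\dashrightarrow X\times Y$; such an inverse is a pair of rational maps $Z\dashrightarrow X$ and $Z\dashrightarrow Y$, given by forms $g_0,\dots,g_n\in k[\mathbf z]$ of one degree and forms $h_0,\dots,h_m\in k[\mathbf z]$ of one degree. Let $\mathcal K\subset k[\mathbf x,\mathbf y,\mathbf z]$ be the presentation ideal of the Rees algebra of the ideal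 $(f_0,\dots,f_s)\subset R$, that is, the kernel of the map $k[\mathbf x,\mathbf y,\mathbf z]\to R[t]$ sending $x_i\mapsto x_i$, $y_j\mapsto y_j$, $z_l\mapsto f_lt$. Choose a finite minimal set of generators $P_1,\dots,P_p$ of the ideal generated by the forms of tridegree $(1,0,*)$ in $\mathcal K$ ($*$ denotes an arbitrary degree in $\mathbf z$), the $P_l$ being forms of such tridegrees, and write $P_l=\sum_iQ_{l,i}(\mathbf z)\,x_i$. The $p\times(n+1)$ matrix $\Psi_{\mathbf x}=(\partial P_l/\partial x_i)=(Q_{l,i})$ over $k[\mathbf z]$ is called an $\mathbf x$-partial Jacobian dual matrix. Define a $\mathbf y$-partial Jacobian dual matrix $\Psi_{\mathbf y}$ in the same way from the forms of tridegree $(0,1,*)$ in $\mathcal K$ and the $\mathbf y$-derivatives. Then, for all such $\Psi_{\mathbf x}$ and $\Psi_{\mathbf y}$, the rational map $\mathcal F$ is birational with image $Z$ if and only if $$\operatorname{rank}_S(\Psi_{\mathbf x}\otimes_{k[\mathbf z]}S)=n\quad\text{and}\quad\operatorname{rank}_S(\Psi_{\mathbf y}\otimes_{k[\mathbf z]}S)=m.$$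 In addition, suppose that $\mathcal F$ is birational with image $Z$. Then $\Psi_{\mathbf x}$ has an $n\times(n+1)$ submatrix of rank $n$ over $S$ and $\Psi_{\mathbf y}$ has an $m\times(m+1)$ submatrix of rank $m$ over $S$. For every such pair of submatrices, the ordered signed maximal minors $(\Delta_0,\dots,\Delta_n)$ of the first and $(\Delta'_0,\dots,\Delta'_m)$ of the second (the $i$-th one being $(-1)^i$ times the determinant of the submatrix with column $i$ deleted, columns being numbered from $0$) are the two halves $\mathbf g$ and $\mathbf h$ of an expression of the inverse of $\mathcal F$. -/

import Mathlib

noncomputable section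

namespace JacobianDual

open MvPolynomial

/-- An irreducible projective variety in `P^n` over `k`, given by its homogeneous ideal: a
homogeneous prime ideal of `k[x_0, …, x_n]` that does not contain all the variables. -/
structure ProjVariety (k : Type*) [Field k] (n : ℕ) where
  ideal : Ideal (MvPolynomial (Fin (n + 1)) k)
  isPrime : ideal.IsPrime
  isHomogeneous : ∀ p ∈ ideal, ∀ d, homogeneousComponent d p ∈ ideal
  exists_notMem : ∃ i, (X i : MvPolynomial (Fin (n + 1)) k) ∉ ideal

variable {k : Type*} [Field k] {n m s : ℕ}

/-- The homogeneous coordinate ring `k[x_0, …, x_n] / I(X)`. -/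
abbrev ProjVariety.CoordRing (V : ProjVariety k n) : Type _ :=
  MvPolynomial (Fin (n + 1)) k ⧸ V.ideal

/-- `V` is non-degenerate: it lies in no hyperplane. -/
def ProjVariety.Nondegenerate (V : ProjVariety k n) : Prop :=
  ∀ l : MvPolynomial (Fin (n + 1)) k, l.IsHomogeneous 1 → l ∈ V.ideal → l = 0

/-- `k[x, y]`, the `x`-variables on the left, the `y`-variables on the right. -/
abbrev PolyXY (k : Type*) [Field k] (n m : ℕ) : Type _ :=
  MvPolynomial (Fin (n + 1) ⊕ Fin (m + 1)) k

/-- `k[x, y, z]`. -/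
abbrev PolyXYZ (k : Type*) [Field k] (n m s : ℕ) : Type _ :=
  MvPolynomial (Fin (n + 1) ⊕ Fin (m + 1) ⊕ Fin (s + 1)) k

/-- The ideal of `k[x, y]` generated by the ideals of `V` and `W`. -/
def prodIdeal (V : ProjVariety k n) (W : ProjVariety k m) : Ideal (PolyXY k n m) :=
  V.ideal.map (rename Sum.inl : _ →ₐ[k] PolyXY k n m) ⊔
    W.ideal.map (rename Sum.inr : _ →ₐ[k] PolyXY k n m)

/-- The bihomogeneous coordinate ring `R = k[x, y] / (I(V), I(W))` of `V × W`. -/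
abbrev ProdRing (V : ProjVariety k n) (W : ProjVariety k m) : Type _ :=
  PolyXY k n m ⧸ prodIdeal V W

/-- The bidegree on `k[x, y]`. -/
def biWeight (n m : ℕ) : Fin (n + 1) ⊕ Fin (m + 1) → ℕ × ℕ :=
  Sum.elim (fun _ => (1, 0)) (fun _ => (0, 1))

/-- The tridegree on `k[x, y, z]`. -/
def triWeight (n m s : ℕ) : Fin (n + 1) ⊕ Fin (m + 1) ⊕ Fin (s + 1) → ℕ × ℕ × ℕ :=
  Sum.elim (fun _ => (1, 0, 0)) (Sum.elim (fun _ => (0, 1, 0)) (fun _ => (0, 0, 1)))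

/-- The map `k[x, y, z] → R[t]` with `x ↦ x`, `y ↦ y`, `z_i ↦ f_i t`; its image is the Rees algebra
`R[It]` of the ideal `I` of `R` generated by the classes of the `f_i`. -/
def reesMap (V : ProjVariety k n) (W : ProjVariety k m) (f : Fin (s + 1) → PolyXY k n m) :
    PolyXYZ k n m s →ₐ[k] Polynomial (ProdRing V W) :=
  aeval (Sum.elim
    (fun i => Polynomial.C (Ideal.Quotient.mk (prodIdeal V W) (X (Sum.inl i))))
    (Sum.elim
      (fun j => Polynomial.C (Ideal.Quotient.mk (prodIdeal V W) (X (Sum.inr j))))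
      (fun l => Polynomial.C (Ideal.Quotient.mk (prodIdeal V W) (f l)) * Polynomial.X)))

/-- The presentation ideal of the Rees algebra of `(f_0, …, f_s) ⊆ R`. -/
def reesIdeal (V : ProjVariety k n) (W : ProjVariety k m) (f : Fin (s + 1) → PolyXY k n m) :
    Ideal (PolyXYZ k n m s) :=
  RingHom.ker (reesMap V W f)

/-- The ideal of `k[z]` generated by the forms `p` with `p(f_0, …, f_s) = 0` in `R`: the
homogeneous ideal of the Zariski closure in `P^s` of the image of the rational map
`(f_0 : … : f_s)` on `V × W`. -/
def imageIdeal (V : ProjVariety k n) (W : ProjVariety k m) (f : Fin (s + 1) → PolyXY k n m) :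
    Ideal (MvPolynomial (Fin (s + 1)) k) :=
  Ideal.span {p | (∃ d, p.IsHomogeneous d) ∧ aeval f p ∈ prodIdeal V W}

/-- A rational map `V × W ⇢ T` given by bihomogeneous polynomials of the same bidegree, not all
zero in `R`. -/
structure BiRatMap (V : ProjVariety k n) (W : ProjVariety k m) (T : ProjVariety k s) where
  f : Fin (s + 1) → PolyXY k n m
  bidegree : ℕ × ℕ
  isBihomogeneous : ∀ l, IsWeightedHomogeneous (biWeight n m) (f l) bidegree
  exists_notMem : ∃ l, f l ∉ prodIdeal V W
  le_imageIdeal : T.ideal ≤ imageIdeal V W f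

/-- A rational map `T ⇢ V` between projective varieties, given by forms of the same degree, not all
zero in the coordinate ring of `T`. -/
structure RatMap (T : ProjVariety k s) (V : ProjVariety k n) where
  g : Fin (n + 1) → MvPolynomial (Fin (s + 1)) k
  degree : ℕ
  isHomogeneous : ∀ i, (g i).IsHomogeneous degree
  exists_notMem : ∃ i, g i ∉ T.ideal
  maps_to : ∀ p ∈ V.ideal, aeval g p ∈ T.ideal

namespace BiRatMap

variable {V : ProjVariety k n} {W : ProjVariety k m} {T : ProjVariety k s}

/-- `F` is dominant: the closure of its image is all of `T`. -/
def Dominant (F : BiRatMap V W T) : Prop :=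
  imageIdeal V W F.f = T.ideal

/-- The pair of rational maps `(G, H) : T ⇢ V × W` is inverse to `F`. Both composites are defined,
and are the identity as rational maps: their coordinate vectors are nonzero and proportional to the
coordinates of the source. -/
structure IsInverse (F : BiRatMap V W T) (G : RatMap T V) (H : RatMap T W) : Prop where
  left_defined : ∃ i, aeval F.f (G.g i) ∉ prodIdeal V W
  left_eq : ∀ i j, aeval F.f (G.g i) * X (Sum.inl j) - aeval F.f (G.g j) * X (Sum.inl i) ∈
    prodIdeal V W
  left_defined' : ∃ i, aeval F.f (H.g i) ∉ prodIdeal V W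
  left_eq' : ∀ i j, aeval F.f (H.g i) * X (Sum.inr j) - aeval F.f (H.g j) * X (Sum.inr i) ∈
    prodIdeal V W
  right_defined : ∃ l, aeval (Sum.elim G.g H.g) (F.f l) ∉ T.ideal
  right_eq : ∀ l r, aeval (Sum.elim G.g H.g) (F.f l) * X r -
    aeval (Sum.elim G.g H.g) (F.f r) * X l ∈ T.ideal

/-- `F` is birational with image `T`: it is dominant and has an inverse rational map. -/
def IsBirational (F : BiRatMap V W T) : Prop :=
  F.Dominant ∧ ∃ (G : RatMap T V) (H : RatMap T W), F.IsInverse G H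

/-- The forms of tridegree `(1, 0, *)` in the presentation ideal of the Rees algebra. -/
def xForms (F : BiRatMap V W T) : Set (PolyXYZ k n m s) :=
  {p | p ∈ reesIdeal V W F.f ∧ ∃ d : ℕ, IsWeightedHomogeneous (triWeight n m s) p (1, 0, d)}

/-- The forms of tridegree `(0, 1, *)` in the presentation ideal of the Rees algebra. -/
def yForms (F : BiRatMap V W T) : Set (PolyXYZ k n m s) :=
  {p | p ∈ reesIdeal V W F.f ∧ ∃ d : ℕ, IsWeightedHomogeneous (triWeight n m s) p (0, 1, d)}

end BiRatMap

/-- The finite family `P` consists of elements of `A` and is a minimal system of generators of the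
ideal generated by `A`. -/
structure IsMinimalGenerators {B : Type*} [CommRing B] (A : Set B) {r : ℕ} (P : Fin r → B) :
    Prop where
  mem : ∀ l, P l ∈ A
  span_eq : Ideal.span (Set.range P) = Ideal.span A
  minimal : ∀ l, P l ∉ Ideal.span (P '' {l' | l' ≠ l})

/-- The projection `k[x, y, z] → k[z]` (`x, y ↦ 0`), the identity on polynomials in `z` alone. -/
def toZ : PolyXYZ k n m s →ₐ[k] MvPolynomial (Fin (s + 1)) k :=
  aeval (Sum.elim (fun _ => 0) (Sum.elim (fun _ => 0) X))

/-- The matrix of `x`-derivatives of the forms `P l`. For forms of tridegree `(1, 0, *)`,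
`P l = ∑ i, Q_{l,i}(z) x_i`, the derivatives are the polynomials `Q_{l,i}` in `z`. -/
def xJacobian {r : ℕ} (P : Fin r → PolyXYZ k n m s) :
    Matrix (Fin r) (Fin (n + 1)) (MvPolynomial (Fin (s + 1)) k) :=
  Matrix.of fun l i => toZ (pderiv (Sum.inl i) (P l))

/-- The matrix of `y`-derivatives of the forms `P l`. -/
def yJacobian {r : ℕ} (P : Fin r → PolyXYZ k n m s) :
    Matrix (Fin r) (Fin (m + 1)) (MvPolynomial (Fin (s + 1)) k) :=
  Matrix.of fun l j => toZ (pderiv (Sum.inr (Sum.inl j)) (P l))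

/-- The rank over the coordinate ring of `T` of a matrix over `k[z]`. -/
def rankOver (T : ProjVariety k s) {r c : ℕ}
    (M : Matrix (Fin r) (Fin c) (MvPolynomial (Fin (s + 1)) k)) : ℕ :=
  (M.map (Ideal.Quotient.mk T.ideal) : Matrix (Fin r) (Fin c) T.CoordRing).rank

/-- The ordered signed maximal minors of an `N × (N + 1)` matrix: the `i`-th one is `(-1)^i` times
the determinant of the matrix without its `i`-th column. -/
def signedMinors {B : Type*} [CommRing B] {N : ℕ} (M : Matrix (Fin N) (Fin (N + 1)) B) :
    Fin (N + 1) → B :=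
  fun i => (-1) ^ (i : ℕ) * (M.submatrix id i.succAbove).det

end JacobianDual

end

/-! Write φ_l for the class of f_l in R and ξ_i for the class of x_i. For forms v_i of one degree d,
the element ∑ v_i(z) x_i goes to (∑ v_i(φ) ξ_i) t^d in R[t]. Hence the rows of Ψ_x generate all
homogeneous k[z]-linear relations between the ξ_i, with z acting through φ (`IsRelationMatrix`,
`isRelationMatrix_pderiv`). The same holds for y.

Two kinds of relations decide the rank. If a form q vanishes at φ, every q e_i is a relation; were q
nonzero in S, the rank would be n + 1, so rank n forces dominance (`mem_ideal_of_rankOver`). If F is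
dominant with inverse g, then g(φ) is proportional to ξ: the relations g_j e_i - g_i e_j give rank
at least n, and g lies in the kernel of Ψ_x over S, so the rank is exactly n
(`rankOver_eq_of_inverse`).

Conversely, R is a domain because k is algebraically closed. After z ↦ φ an n × (n+1) submatrix of
Ψ_x kills the nonzero vector ξ, so by Cramer its signed minors are proportional to ξ
(`signedMinors_mul_eq`). When the submatrix has rank n over S they are not all zero there. Dominance
lets identities between forms be checked in R; this shows that the minors map Z to X
(`aeval_mem_of_proportional`) and, with their y-analogues, invert F (`isInverse_of_proportional`).
-/

noncomputable section

namespace JacobianDual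

/-! ### Algebra over domains: tensor products, scaling, ranks and minors -/

section TensorRank

open MvPolynomial TensorProduct

/-- Over an algebraically closed field, the tensor product of a finitely generated domain
`k[x] / I` with any domain is a domain. -/
theorem isDomain_quotient_tensorProduct {k : Type*} [Field k] [IsAlgClosed k] {σ : Type*}
    [Finite σ] (I : Ideal (MvPolynomial σ k)) [I.IsPrime] (B : Type*) [CommRing B] [Algebra k B]
    [IsDomain B] : IsDomain ((MvPolynomial σ k ⧸ I) ⊗[k] B) := by
  have : Nontrivial ((MvPolynomial σ k ⧸ I) ⊗[k] B) := inferInstance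
  refine @NoZeroDivisors.to_isDomain _ _ this ⟨fun {u v} huv => ?_⟩
  by_contra! hne
  let b := Module.Basis.ofVectorSpace k B
  -- Expand w in a k-basis of B and let a lift a nonzero coefficient. Specialising the left factor
  -- at a point where a does not vanish keeps that coefficient, hence w, nonzero.
  have key : ∀ w : (MvPolynomial σ k ⧸ I) ⊗[k] B, w ≠ 0 → ∃ a : MvPolynomial σ k, a ∉ I ∧
      ∀ χ : (MvPolynomial σ k ⧸ I) →ₐ[k] k, χ (Ideal.Quotient.mk I a) ≠ 0 →
        Algebra.TensorProduct.lift ((Algebra.ofId k B).comp χ) (AlgHom.id k B)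
          (fun _ _ => Commute.all _ _) w ≠ 0 := by
    intro w hw
    obtain ⟨c, rfl⟩ := TensorProduct.eq_repr_basis_right b w
    obtain ⟨i, hi⟩ : ∃ i, c i ≠ 0 := by
      by_contra! h
      exact hw (by simp [show c = 0 from Finsupp.ext h])
    obtain ⟨a, ha⟩ := Ideal.Quotient.mk_surjective (c i)
    refine ⟨a, fun h => hi (by rw [← ha, Ideal.Quotient.eq_zero_iff_mem.2 h]), fun χ hχ h => hχ ?_⟩
    rw [ha]
    have h1 : Finsupp.linearCombination k b (c.mapRange χ (map_zero χ)) = 0 := by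
      rw [Finsupp.linearCombination_apply, Finsupp.sum_mapRange_index (by simp), ← h, Finsupp.sum,
        Finsupp.sum, map_sum]
      refine Finset.sum_congr rfl fun j _ => ?_
      simp [Algebra.ofId_apply, Algebra.smul_def]
    have h2 := DFunLike.congr_fun
      ((linearIndependent_iff.1 b.linearIndependent) _ h1) i
    simpa using h2
  obtain ⟨a, ha, hau⟩ := key u hne.1
  obtain ⟨a', ha', hav⟩ := key v hne.2
  have haa : a * a' ∉ I := fun h => ((Ideal.IsPrime.mem_or_mem ‹_› h).elim ha ha')
  -- By the Nullstellensatz some point of the zero locus of I avoids a a'. There u and v specialise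
  -- to nonzero elements of the domain B with product zero.
  rw [← IsPrime.vanishingIdeal_zeroLocus (K := k) I, mem_vanishingIdeal_iff] at haa
  push Not at haa
  obtain ⟨x, hx, hxa⟩ := haa
  let χ : (MvPolynomial σ k ⧸ I) →ₐ[k] k := Ideal.Quotient.liftₐ I (aeval x) fun p hp => hx p hp
  rw [map_mul] at hxa
  have h1 := hau χ (left_ne_zero_of_mul hxa)
  have h2 := hav χ (right_ne_zero_of_mul hxa)
  exact mul_ne_zero h1 h2 (by rw [← map_mul, huv, map_zero])

/-! ### The bihomogeneous coordinate ring R -/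

section ProdRing

variable {k : Type*} [Field k] {n m : ℕ} (V : ProjVariety k n) (W : ProjVariety k m)

instance (V : ProjVariety k n) : V.ideal.IsPrime := V.isPrime

/-- The map from `k[x, y]` to the tensor product of the coordinate rings. -/
def polyXYToTensor : PolyXY k n m →ₐ[k] V.CoordRing ⊗[k] W.CoordRing :=
  aeval (Sum.elim (fun i => Ideal.Quotient.mk V.ideal (X i) ⊗ₜ[k] (1 : W.CoordRing))
    (fun j => (1 : V.CoordRing) ⊗ₜ[k] Ideal.Quotient.mk W.ideal (X j)))

theorem prodIdeal_le_ker_polyXYToTensor :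
    prodIdeal V W ≤ RingHom.ker (polyXYToTensor V W) := by
  refine sup_le (Ideal.map_le_iff_le_comap.2 ?_) (Ideal.map_le_iff_le_comap.2 ?_)
  · intro q hq
    have : (polyXYToTensor V W).comp (rename Sum.inl) =
        (Algebra.TensorProduct.includeLeft : V.CoordRing →ₐ[k] _).comp
          (Ideal.Quotient.mkₐ k V.ideal) := by
      ext i; simp [polyXYToTensor]
    have h := DFunLike.congr_fun this q
    rw [AlgHom.comp_apply] at h
    rw [Ideal.mem_comap, RingHom.mem_ker, h]
    simp [Ideal.Quotient.eq_zero_iff_mem.2 hq]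
  · intro q hq
    have : (polyXYToTensor V W).comp (rename Sum.inr) =
        (Algebra.TensorProduct.includeRight : W.CoordRing →ₐ[k] _).comp
          (Ideal.Quotient.mkₐ k W.ideal) := by
      ext i; simp [polyXYToTensor]
    have h := DFunLike.congr_fun this q
    rw [AlgHom.comp_apply] at h
    rw [Ideal.mem_comap, RingHom.mem_ker, h]
    simp [Ideal.Quotient.eq_zero_iff_mem.2 hq]

/-- The map from `k[x, y] / (I(V), I(W))` to the tensor product of the coordinate rings. -/
def prodRingToTensor : ProdRing V W →ₐ[k] V.CoordRing ⊗[k] W.CoordRing :=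
  Ideal.Quotient.liftₐ (prodIdeal V W) (polyXYToTensor V W)
    fun _ hp => prodIdeal_le_ker_polyXYToTensor V W hp

/-- The universal property of the tensor product supplies a left inverse. -/
theorem prodRingToTensor_injective : Function.Injective (prodRingToTensor V W) := by
  let a : V.CoordRing →ₐ[k] ProdRing V W := Ideal.Quotient.liftₐ V.ideal
    ((Ideal.Quotient.mkₐ k (prodIdeal V W)).comp (rename Sum.inl)) fun p hp =>
      Ideal.Quotient.eq_zero_iff_mem.2 (Ideal.mem_sup_left (Ideal.mem_map_of_mem _ hp))
  let b : W.CoordRing →ₐ[k] ProdRing V W := Ideal.Quotient.liftₐ W.ideal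
    ((Ideal.Quotient.mkₐ k (prodIdeal V W)).comp (rename Sum.inr)) fun p hp =>
      Ideal.Quotient.eq_zero_iff_mem.2 (Ideal.mem_sup_right (Ideal.mem_map_of_mem _ hp))
  have h : (Algebra.TensorProduct.lift a b fun _ _ => Commute.all _ _).comp
      (prodRingToTensor V W) = AlgHom.id k _ := by
    apply Ideal.Quotient.algHom_ext
    ext i
    have hmk : ∀ q, prodRingToTensor V W (Ideal.Quotient.mk _ q) = polyXYToTensor V W q :=
      fun _ => rfl
    have ha : ∀ q, a (Ideal.Quotient.mk _ q) = Ideal.Quotient.mk _ (rename Sum.inl q) :=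
      fun _ => rfl
    have hb : ∀ q, b (Ideal.Quotient.mk _ q) = Ideal.Quotient.mk _ (rename Sum.inr q) :=
      fun _ => rfl
    rcases i with i | i
    · simp [hmk, polyXYToTensor, ha]
    · simp [hmk, polyXYToTensor, hb]
  exact Function.LeftInverse.injective (g := Algebra.TensorProduct.lift a b fun _ _ =>
    Commute.all _ _) fun x => DFunLike.congr_fun h x

instance isDomain_prodRing [IsAlgClosed k] : IsDomain (ProdRing V W) :=
  have := isDomain_quotient_tensorProduct V.ideal W.CoordRing
  (prodRingToTensor_injective V W).isDomain (prodRingToTensor V W).toRingHom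

/-- By homogeneity the constant term lies in the prime ideal, so it cannot be a unit. -/
theorem ProjVariety.constantCoeff_eq_zero {p : MvPolynomial (Fin (n + 1)) k} (hp : p ∈ V.ideal) :
    constantCoeff p = 0 := by
  by_contra h
  have h0 := V.isHomogeneous p hp 0
  rw [homogeneousComponent_zero] at h0
  exact V.isPrime.ne_top (Ideal.eq_top_of_isUnit_mem _ h0 ((isUnit_iff_ne_zero.2 h).map C))

/-- Setting y = 0 is well defined from R to the coordinate ring of V, since elements of I(W) have no
constant term; some x_i survives there. -/
theorem exists_mk_X_inl_ne_zero :
    ∃ i, Ideal.Quotient.mk (prodIdeal V W) (X (Sum.inl i)) ≠ 0 := by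
  obtain ⟨i, hi⟩ := V.exists_notMem
  refine ⟨i, fun h => hi ?_⟩
  rw [Ideal.Quotient.eq_zero_iff_mem] at h
  let ψ : PolyXY k n m →ₐ[k] V.CoordRing :=
    aeval (Sum.elim (fun i => Ideal.Quotient.mk V.ideal (X i)) fun _ => 0)
  have hψ : prodIdeal V W ≤ RingHom.ker ψ := by
    refine sup_le (Ideal.map_le_iff_le_comap.2 ?_) (Ideal.map_le_iff_le_comap.2 ?_)
    · intro q hq
      have : (aeval fun i => (Ideal.Quotient.mk V.ideal (X i))) =
            (Ideal.Quotient.mkₐ k V.ideal) := by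
        ext i; simp
      simp only [Ideal.mem_comap, RingHom.mem_ker, ψ]
      erw [aeval_rename]
      rw [Sum.elim_comp_inl, this]
      simp [Ideal.Quotient.eq_zero_iff_mem.2 hq]
    · intro q hq
      simp only [Ideal.mem_comap, RingHom.mem_ker, ψ]
      erw [aeval_rename]
      rw [Sum.elim_comp_inr, aeval_zero', W.constantCoeff_eq_zero hq, map_zero]
  have := hψ h
  rw [RingHom.mem_ker] at this
  simpa [ψ, Ideal.Quotient.eq_zero_iff_mem] using this

theorem exists_mk_X_inr_ne_zero :
    ∃ j, Ideal.Quotient.mk (prodIdeal V W) (X (Sum.inr j)) ≠ 0 := by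
  obtain ⟨i, hi⟩ := W.exists_notMem
  refine ⟨i, fun h => hi ?_⟩
  rw [Ideal.Quotient.eq_zero_iff_mem] at h
  let ψ : PolyXY k n m →ₐ[k] W.CoordRing :=
    aeval (Sum.elim (fun _ => 0) fun i => Ideal.Quotient.mk W.ideal (X i))
  have hψ : prodIdeal V W ≤ RingHom.ker ψ := by
    refine sup_le (Ideal.map_le_iff_le_comap.2 ?_) (Ideal.map_le_iff_le_comap.2 ?_)
    · intro q hq
      simp only [Ideal.mem_comap, RingHom.mem_ker, ψ]
      erw [aeval_rename]
      rw [Sum.elim_comp_inl, aeval_zero', V.constantCoeff_eq_zero hq, map_zero]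
    · intro q hq
      have : (aeval fun i => (Ideal.Quotient.mk W.ideal (X i))) =
            (Ideal.Quotient.mkₐ k W.ideal) := by
        ext i; simp
      simp only [Ideal.mem_comap, RingHom.mem_ker, ψ]
      erw [aeval_rename]
      rw [Sum.elim_comp_inr, this]
      simp [Ideal.Quotient.eq_zero_iff_mem.2 hq]
  have := hψ h
  rw [RingHom.mem_ker] at this
  simpa [ψ, Ideal.Quotient.eq_zero_iff_mem] using this

end ProdRing

/-! ### Scaling the arguments of homogeneous polynomials -/

section Scaling

variable {k : Type*} [CommSemiring k] {σ : Type*} {B : Type*} [CommSemiring B] [Algebra k B]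

/-- Scaling the arguments of a weighted homogeneous polynomial by a character of the weights. -/
theorem aeval_mul_of_isWeightedHomogeneous {M : Type*} [AddCommMonoid M] {w : σ → M}
    {p : MvPolynomial σ k} {d : M} (hp : IsWeightedHomogeneous w p d) (a : σ → B)
    (χ : Multiplicative M →* B) :
    aeval (fun i => a i * χ (.ofAdd (w i))) p = aeval a p * χ (.ofAdd d) := by
  conv_lhs => rw [p.as_sum]
  conv_rhs => rw [p.as_sum]
  rw [map_sum, map_sum, Finset.sum_mul]
  refine Finset.sum_congr rfl fun u hu => ?_
  have hw : Finsupp.weight w u = d := hp (mem_support_iff.1 hu)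
  rw [aeval_monomial, aeval_monomial, mul_assoc, ← hw]
  congr 1
  simp only [mul_pow]
  rw [Finsupp.prod_mul]
  congr 1
  simp [Finsupp.weight_apply, Finsupp.prod, Finsupp.sum, ofAdd_sum, map_prod, ofAdd_nsmul]

theorem aeval_mul_of_isHomogeneous {p : MvPolynomial σ k} {d : ℕ} (hp : p.IsHomogeneous d)
    (a : σ → B) (t : B) : aeval (fun i => a i * t) p = aeval a p * t ^ d := by
  simpa [powersHom_apply] using aeval_mul_of_isWeightedHomogeneous hp a (powersHom B t)

theorem aeval_mul_of_isBihomogeneous {k : Type*} [Field k] [Algebra k B] {n m : ℕ}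
    {p : PolyXY k n m} {d : ℕ × ℕ}
    (hp : IsWeightedHomogeneous (biWeight n m) p d) (a : Fin (n + 1) → B) (b : Fin (m + 1) → B)
    (t u : B) : aeval (Sum.elim (fun i => a i * t) (fun j => b j * u)) p =
      aeval (Sum.elim a b) p * (t ^ d.1 * u ^ d.2) := by
  let χ : Multiplicative (ℕ × ℕ) →* B :=
    { toFun := fun e => t ^ e.toAdd.1 * u ^ e.toAdd.2
      map_one' := by simp
      map_mul' := fun x y => by simp only [toAdd_mul, Prod.fst_add, Prod.snd_add]; ring }
  have := aeval_mul_of_isWeightedHomogeneous hp (Sum.elim a b) χ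
  convert! this using 3
  ext i
  rcases i with i | i <;> simp [χ, biWeight]

end Scaling

/-! ### Ranks and signed maximal minors -/

section Rank

/-- The rank of a matrix over a domain is its rank over the fraction field. -/
theorem rank_map_algebraMap {S K : Type*} [CommRing S] [IsDomain S] [Field K] [Algebra S K]
    [IsFractionRing S K] {r c : ℕ} (M : Matrix (Fin r) (Fin c) S) :
    (M.map (algebraMap S K)).rank = M.rank := by
  let f : (Fin r → S) →ₗ[S] (Fin r → K) := LinearMap.pi fun i =>
    Algebra.linearMap S K ∘ₗ LinearMap.proj i
  have : IsLocalizedModule (nonZeroDivisors S) f := inferInstance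
  rw [Matrix.rank_eq_finrank_span_cols, Matrix.rank_eq_finrank_span_cols]
  -- The column space over K is the localization of the column span over S, and localizing at
  -- nonzerodivisors preserves the rank.
  have h := IsLocalizedModule.finrank_eq (nonZeroDivisors S)
    ((Submodule.span S (Set.range M.col)).toLocalized' K (nonZeroDivisors S) f) le_rfl
  rw [← h, ← IsFractionRing.finrank_right_eq S K, Submodule.localized'_span, ← Set.range_comp]
  rfl

variable {K : Type*} [Field K] {N r : ℕ}

theorem linearIndependent_row_of_rank {c : ℕ} {M : Matrix (Fin N) (Fin c) K} (h : M.rank = N) :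
    LinearIndependent K M.row := by
  rw [linearIndependent_iff_card_eq_finrank_span, Set.finrank, ← M.rank_eq_finrank_span_row, h,
    Fintype.card_fin]

/-- Rows forming a basis of the row space will do, listed in increasing order of index. -/
theorem exists_rank_submatrix {c : ℕ} {M : Matrix (Fin r) (Fin c) K} (h : M.rank = N) :
    ∃ σ : Fin N ↪o Fin r, (M.submatrix σ id).rank = N := by
  classical
  obtain ⟨κ, a, ha, hspan, hind⟩ := exists_linearIndependent' K M.row
  have : Finite κ := Finite.of_injective a ha
  cases nonempty_fintype κ
  have hcard : Fintype.card κ = N := by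
    rw [linearIndependent_iff_card_eq_finrank_span.1 hind, Set.finrank, hspan,
      ← M.rank_eq_finrank_span_row, h]
  let t : Finset (Fin r) := Finset.univ.image a
  have ht : t.card = N := by
    rw [Finset.card_image_of_injective _ ha, Finset.card_univ, hcard]
  refine ⟨t.orderEmbOfFin ht, ?_⟩
  rw [Matrix.rank_eq_finrank_span_row]
  have : Set.range (M.submatrix (t.orderEmbOfFin ht) id).row = Set.range (M.row ∘ a) := by
    have : (M.submatrix (t.orderEmbOfFin ht) id).row = M.row ∘ t.orderEmbOfFin ht := rfl
    rw [this, Set.range_comp, Set.range_comp, Finset.range_orderEmbOfFin]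
    simp [t]
  rw [this, hspan, ← M.rank_eq_finrank_span_row, h]

/-- Expansion of a determinant along its first row. -/
theorem det_cons_eq_sum_signedMinors {B : Type*} [CommRing B] (M : Matrix (Fin N) (Fin (N + 1)) B)
    (v : Fin (N + 1) → B) :
    (Matrix.of (Fin.cons v M.row : Fin (N + 1) → Fin (N + 1) → B)).det =
      ∑ i, v i * signedMinors M i := by
  rw [Matrix.det_succ_row_zero]
  refine Finset.sum_congr rfl fun i _ => ?_
  have h1 : (Matrix.of (Fin.cons v M.row : Fin (N + 1) → Fin (N + 1) → B)).submatrix Fin.succ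
      i.succAbove = M.submatrix id i.succAbove := by
    ext; rfl
  rw [h1, signedMinors, Matrix.of_apply, Fin.cons_zero]
  ring

/-- Put a vector outside the row space on top of M: the square matrix is invertible, and its
determinant is a combination of the signed minors. -/
theorem exists_signedMinors_ne_zero {M : Matrix (Fin N) (Fin (N + 1)) K} (h : M.rank = N) :
    ∃ i, signedMinors M i ≠ 0 := by
  have hind := linearIndependent_row_of_rank h
  obtain ⟨v, hv⟩ : ∃ v, v ∉ Submodule.span K (Set.range M.row) := by
    by_contra! hall
    have h1 := M.rank_eq_finrank_span_row
    rw [(Submodule.eq_top_iff'.2 hall), finrank_top, Module.finrank_fin_fun, h] at h1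
    omega
  by_contra! h0
  have hdet := det_cons_eq_sum_signedMinors M v
  simp only [h0, mul_zero, Finset.sum_const_zero] at hdet
  have hli : LinearIndependent K (Fin.cons v M.row : Fin (N + 1) → Fin (N + 1) → K) :=
    linearIndependent_finCons.2 ⟨hind, hv⟩
  have := (Matrix.linearIndependent_rows_iff_isUnit
    (A := Matrix.of (Fin.cons v M.row : Fin (N + 1) → Fin (N + 1) → K))).1 hli
  rw [Matrix.isUnit_iff_isUnit_det] at this
  exact this.ne_zero hdet

/-- The signed maximal minors are proportional to any nonzero element of the kernel. -/
theorem signedMinors_mul_eq {B : Type*} [CommRing B] [IsDomain B]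
    (M : Matrix (Fin N) (Fin (N + 1)) B) {ξ : Fin (N + 1) → B} (hξ : ξ ≠ 0)
    (h : ∀ l, ∑ i, M l i * ξ i = 0) (i j : Fin (N + 1)) :
    signedMinors M i * ξ j = signedMinors M j * ξ i := by
  classical
  -- The added row ξ_j e_i - ξ_i e_j also kills ξ, so the determinant vanishes; expanding along that
  -- row is the claimed identity.
  have hdet : (Matrix.of (Fin.cons (Pi.single i (ξ j) - Pi.single j (ξ i)) M.row :
      Fin (N + 1) → Fin (N + 1) → B)).det = 0 := by
    rw [← Matrix.exists_mulVec_eq_zero_iff]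
    refine ⟨ξ, hξ, ?_⟩
    ext l
    refine Fin.cases ?_ (fun l => ?_) l
    · simp [Matrix.mulVec, dotProduct, Pi.single_apply, sub_mul, Finset.sum_sub_distrib,
        mul_comm (ξ i)]
    · exact h l
  rw [det_cons_eq_sum_signedMinors] at hdet
  simp only [Pi.sub_apply, sub_mul, Finset.sum_sub_distrib, Pi.single_apply, ite_mul, zero_mul,
    Finset.sum_ite_eq', Finset.mem_univ, if_true] at hdet
  linear_combination hdet

theorem rank_eq_of_single_mem_span {M : Matrix (Fin r) (Fin N) K} {q : K} (hq : q ≠ 0)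
    (h : ∀ i, Pi.single i q ∈ Submodule.span K (Set.range M.row)) : M.rank = N := by
  have : Submodule.span K (Set.range M.row) = ⊤ := by
    rw [eq_top_iff, ← (Pi.basisFun K (Fin N)).span_eq, Submodule.span_le]
    rintro _ ⟨i, rfl⟩
    have := Submodule.smul_mem _ q⁻¹ (h i)
    rwa [← Pi.single_smul, smul_eq_mul, inv_mul_cancel₀ hq, ← Pi.basisFun_apply] at this
  rw [Matrix.rank_eq_finrank_span_row, this, finrank_top, Module.finrank_fin_fun]

/-- The kernel contains g ≠ 0, so the rank is at most N. Modulo the row space every e_i is a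
multiple of e_j, so the row space has codimension at most one. -/
theorem rank_eq_of_kernel {M : Matrix (Fin r) (Fin (N + 1)) K} {g : Fin (N + 1) → K}
    {j : Fin (N + 1)} (hg : g j ≠ 0) (hM : ∀ l, ∑ i, M l i * g i = 0)
    (h : ∀ i, Pi.single i (g j) - Pi.single j (g i) ∈ Submodule.span K (Set.range M.row)) :
    M.rank = N := by
  apply le_antisymm
  · have h1 := LinearMap.finrank_range_add_finrank_ker M.mulVecLin
    have h2 : LinearMap.ker M.mulVecLin ≠ ⊥ := by
      refine (Submodule.ne_bot_iff _).2 ⟨g, ?_, fun h0 => hg (by simp [h0])⟩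
      ext l
      simpa [Matrix.mulVec, dotProduct] using hM l
    have h3 : 0 < Module.finrank K (LinearMap.ker M.mulVecLin) :=
      Nat.pos_of_ne_zero fun h => h2 (Submodule.finrank_eq_zero.1 h)
    rw [Module.finrank_fin_fun] at h1
    change Module.finrank K (LinearMap.range M.mulVecLin) ≤ N
    omega
  · have htop : Submodule.span K (Set.range M.row) ⊔ K ∙ (Pi.single j 1 : Fin (N + 1) → K) = ⊤ := by
      rw [eq_top_iff, ← (Pi.basisFun K (Fin (N + 1))).span_eq, Submodule.span_le]
      rintro _ ⟨i, rfl⟩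
      have h1 := Submodule.smul_mem _ (g j)⁻¹ (h i)
      rw [smul_sub, ← Pi.single_smul, ← Pi.single_smul, smul_eq_mul, inv_mul_cancel₀ hg] at h1
      have h2 : (Pi.single j ((g j)⁻¹ • g i) : Fin (N + 1) → K) ∈
          K ∙ (Pi.single j 1 : Fin (N + 1) → K) :=
        Submodule.mem_span_singleton.2 ⟨(g j)⁻¹ • g i, by simp [← Pi.single_smul]⟩
      have := Submodule.add_mem_sup h1 h2
      rw [sub_add_cancel] at this
      simpa using this
    have h1 := Submodule.finrank_add_le_finrank_add_finrank (Submodule.span K (Set.range M.row))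
      (K ∙ (Pi.single j 1 : Fin (N + 1) → K))
    rw [htop, finrank_top, Module.finrank_fin_fun, ← M.rank_eq_finrank_span_row,
      finrank_span_singleton (by simp)] at h1
    omega

end Rank

end TensorRank

/-! ### Matrices of relations and their rank over S -/

section RelationMatrix

open MvPolynomial

variable {k : Type*} [Field k] {s : ℕ}

/-- The map from `k[z]` to the function field of the affine cone over `T`. -/
def toFractionRing (T : ProjVariety k s) :
    MvPolynomial (Fin (s + 1)) k →+* FractionRing T.CoordRing :=
  (algebraMap T.CoordRing (FractionRing T.CoordRing)).comp (Ideal.Quotient.mk T.ideal)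

theorem toFractionRing_eq_zero_iff {T : ProjVariety k s} {p : MvPolynomial (Fin (s + 1)) k} :
    toFractionRing T p = 0 ↔ p ∈ T.ideal := by
  rw [toFractionRing, RingHom.comp_apply, IsFractionRing.to_map_eq_zero_iff,
    Ideal.Quotient.eq_zero_iff_mem]

theorem rankOver_eq (T : ProjVariety k s) {r c : ℕ}
    (M : Matrix (Fin r) (Fin c) (MvPolynomial (Fin (s + 1)) k)) :
    rankOver T M = (M.map (toFractionRing T)).rank := by
  rw [rankOver, ← rank_map_algebraMap (K := FractionRing T.CoordRing), Matrix.map_map]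
  rfl

theorem map_signedMinors {A B : Type*} [CommRing A] [CommRing B] (ψ : A →+* B) {N : ℕ}
    (M : Matrix (Fin N) (Fin (N + 1)) A) (i : Fin (N + 1)) :
    ψ (signedMinors M i) = signedMinors (M.map ψ) i := by
  rw [signedMinors, signedMinors, map_mul, map_pow, map_neg, map_one, RingHom.map_det]
  rfl

theorem map_mem_span_row {A B : Type*} [CommRing A] [CommRing B] (ψ : A →+* B) {r c : ℕ}
    {M : Matrix (Fin r) (Fin c) A} {v : Fin c → A} (h : v ∈ Submodule.span A (Set.range M)) :
    ψ ∘ v ∈ Submodule.span B (Set.range (M.map ψ).row) := by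
  obtain ⟨a, rfl⟩ := (Submodule.mem_span_range_iff_exists_fun A).1 h
  refine (Submodule.mem_span_range_iff_exists_fun B).2 ⟨fun l => ψ (a l), ?_⟩
  ext i
  simp [Finset.sum_apply]

theorem signedMinors_isHomogeneous {N : ℕ}
    {M : Matrix (Fin N) (Fin (N + 1)) (MvPolynomial (Fin (s + 1)) k)} {d : Fin N → ℕ}
    (h : ∀ l i, (M l i).IsHomogeneous (d l)) (i : Fin (N + 1)) :
    (signedMinors M i).IsHomogeneous (∑ l, d l) := by
  have h1 : (M.submatrix id i.succAbove).det.IsHomogeneous (∑ l, d l) := by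
    -- Transposing indexes the factors of each Leibniz term by rows, and each row has a single
    -- degree.
    rw [← Matrix.det_transpose, Matrix.det_apply]
    refine IsHomogeneous.sum _ _ _ fun σ _ => ?_
    have := IsHomogeneous.prod Finset.univ
      (fun l => (M.submatrix id i.succAbove).transpose (σ l) l) d fun l _ => h l _
    rcases Int.units_eq_one_or (Equiv.Perm.sign σ) with h | h
    · simpa [h] using this
    · simpa [h] using this.neg
  have h2 : ((-1) ^ (i : ℕ) : MvPolynomial (Fin (s + 1)) k) = C ((-1) ^ (i : ℕ)) := by simp
  rw [signedMinors, h2]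
  exact h1.C_mul _

/-- The rows of `M` are homogeneous vectors that generate the module of the homogeneous `k[z]`-linear
relations between the `ξ i`, where `z_l` acts as `φ l`. -/
structure IsRelationMatrix {R : Type*} [CommRing R] [Algebra k R] (φ : Fin (s + 1) → R)
    {N r : ℕ} (ξ : Fin (N + 1) → R)
    (M : Matrix (Fin r) (Fin (N + 1)) (MvPolynomial (Fin (s + 1)) k)) : Prop where
  isHomogeneous : ∀ l, ∃ d, ∀ i, (M l i).IsHomogeneous d
  sum_eq_zero : ∀ l, ∑ i, aeval φ (M l i) * ξ i = 0
  mem_span : ∀ (v : Fin (N + 1) → MvPolynomial (Fin (s + 1)) k) (d : ℕ),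
    (∀ i, (v i).IsHomogeneous d) → ∑ i, aeval φ (v i) * ξ i = 0 →
      v ∈ Submodule.span (MvPolynomial (Fin (s + 1)) k) (Set.range M)

namespace IsRelationMatrix

variable {R : Type*} [CommRing R] [Algebra k R] {φ : Fin (s + 1) → R} {N r : ℕ}
  {ξ : Fin (N + 1) → R} {M : Matrix (Fin r) (Fin (N + 1)) (MvPolynomial (Fin (s + 1)) k)}
  {T : ProjVariety k s}

/-- If `M` has rank `N` over `T`, then no form outside `I(T)` vanishes at `φ`. -/
theorem mem_ideal_of_rankOver (hM : IsRelationMatrix φ ξ M) (h : rankOver T M = N)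
    {q : MvPolynomial (Fin (s + 1)) k} {d : ℕ} (hq : q.IsHomogeneous d) (h0 : aeval φ q = 0) :
    q ∈ T.ideal := by
  by_contra hqT
  rw [← toFractionRing_eq_zero_iff] at hqT
  -- Since q(φ) = 0, every q e_i is a relation, and q is invertible in the fraction field.
  have : (M.map (toFractionRing T)).rank = N + 1 := by
    refine rank_eq_of_single_mem_span hqT fun i => ?_
    have h1 := map_mem_span_row (toFractionRing T) (hM.mem_span (Pi.single i q) d (fun j => by
      rcases eq_or_ne j i with rfl | hj
      · simpa using hq
      · simpa [hj] using isHomogeneous_zero _ _ _) (Finset.sum_eq_zero fun j _ => by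
      rcases eq_or_ne j i with rfl | hj
      · simp [h0]
      · simp [hj]))
    convert! h1 using 1
    ext j
    simp [Pi.single_apply, apply_ite (toFractionRing T)]
  rw [← rankOver_eq, h] at this
  omega

/-- Proportionality of g(φ) and ξ makes each g_j e_i - g_i e_j a relation, and puts g in the kernel
of M over T; `rank_eq_of_kernel` then applies. -/
theorem rankOver_eq_of_inverse [IsDomain R] (hM : IsRelationMatrix φ ξ M) (hξ : ∃ i, ξ i ≠ 0)
    (hT : ∀ (q : MvPolynomial (Fin (s + 1)) k) (d : ℕ), q.IsHomogeneous d → aeval φ q = 0 →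
      q ∈ T.ideal) {g : Fin (N + 1) → MvPolynomial (Fin (s + 1)) k} {e : ℕ}
    (hg : ∀ i, (g i).IsHomogeneous e) (hg0 : ∃ i, g i ∉ T.ideal)
    (h : ∀ i j, aeval φ (g i) * ξ j = aeval φ (g j) * ξ i) : rankOver T M = N := by
  obtain ⟨j, hj⟩ := hg0
  rw [← toFractionRing_eq_zero_iff] at hj
  rw [rankOver_eq]
  refine rank_eq_of_kernel (g := toFractionRing T ∘ g) hj (fun l => ?_) (fun i => ?_)
  · obtain ⟨d, hd⟩ := hM.isHomogeneous l
    have h1 : ∑ i, M l i * g i ∈ T.ideal := by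
      refine hT _ (d + e) (IsHomogeneous.sum _ _ _ fun i _ => (hd i).mul (hg i)) ?_
      -- Multiplying by ξ_c ≠ 0 allows g_i(φ) ξ_c to be exchanged for g_c(φ) ξ_i, which turns the
      -- sum into a multiple of the relation in row l.
      obtain ⟨c, hc⟩ := hξ
      refine (mul_eq_zero.1 (?_ : _ * ξ c = 0)).resolve_right hc
      have h2 := hM.sum_eq_zero l
      calc aeval φ (∑ i, M l i * g i) * ξ c = ∑ i, aeval φ (M l i) * (aeval φ (g i) * ξ c) := by
            simp [map_sum, Finset.sum_mul, mul_assoc]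
        _ = aeval φ (g c) * ∑ i, aeval φ (M l i) * ξ i := by
            rw [Finset.mul_sum]
            exact Finset.sum_congr rfl fun i _ => by rw [h i c]; ring
        _ = 0 := by rw [h2, mul_zero]
    simpa using toFractionRing_eq_zero_iff.2 h1
  · have h1 := map_mem_span_row (toFractionRing T)
      (hM.mem_span (Pi.single i (g j) - Pi.single j (g i)) e (fun c => by
        refine IsHomogeneous.sub ?_ ?_ <;> rw [Pi.single_apply] <;> split_ifs <;>
          first | exact hg _ | exact isHomogeneous_zero _ _ _)
        (by
          simp only [Pi.sub_apply, map_sub, sub_mul, Finset.sum_sub_distrib, Pi.single_apply,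
            apply_ite (aeval φ), map_zero, ite_mul, zero_mul, Finset.sum_ite_eq',
            Finset.mem_univ, if_true]
          rw [h j i, sub_self]))
    convert! h1 using 1
    ext c
    simp [Pi.single_apply, apply_ite (toFractionRing T)]

theorem signedMinors_mul_eq [IsDomain R] (hM : IsRelationMatrix φ ξ M) (hξ : ∃ i, ξ i ≠ 0)
    (σ : Fin N → Fin r) (i j : Fin (N + 1)) :
    aeval φ (signedMinors (M.submatrix σ id) i) * ξ j =
      aeval φ (signedMinors (M.submatrix σ id) j) * ξ i := by
  have h := JacobianDual.signedMinors_mul_eq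
    ((M.submatrix σ id).map (aeval φ : MvPolynomial (Fin (s + 1)) k →ₐ[k] R).toRingHom)
    (ξ := ξ) (fun h => hξ.elim fun i hi => hi (by simp [h])) (fun l => hM.sum_eq_zero (σ l)) i j
  rw [← map_signedMinors, ← map_signedMinors] at h
  exact h

theorem signedMinors_isHomogeneous (hM : IsRelationMatrix φ ξ M) (σ : Fin N → Fin r) :
    ∃ d, ∀ i, (signedMinors (M.submatrix σ id) i).IsHomogeneous d := by
  choose d hd using hM.isHomogeneous
  exact ⟨_, JacobianDual.signedMinors_isHomogeneous (d := fun l => d (σ l)) fun l i => hd (σ l) i⟩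

end IsRelationMatrix

theorem exists_signedMinors_notMem {T : ProjVariety k s} {N : ℕ}
    {M : Matrix (Fin N) (Fin (N + 1)) (MvPolynomial (Fin (s + 1)) k)} (h : rankOver T M = N) :
    ∃ i, signedMinors M i ∉ T.ideal := by
  rw [rankOver_eq] at h
  obtain ⟨i, hi⟩ := exists_signedMinors_ne_zero h
  refine ⟨i, fun h0 => hi ?_⟩
  rw [← map_signedMinors, toFractionRing_eq_zero_iff.2 h0]

theorem exists_rankOver_submatrix {T : ProjVariety k s} {N r c : ℕ}
    {M : Matrix (Fin r) (Fin c) (MvPolynomial (Fin (s + 1)) k)} (h : rankOver T M = N) :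
    ∃ σ : Fin N ↪o Fin r, rankOver T (M.submatrix σ id) = N := by
  rw [rankOver_eq] at h
  obtain ⟨σ, hσ⟩ := exists_rank_submatrix h
  exact ⟨σ, by rw [rankOver_eq]; exact hσ⟩

end RelationMatrix

/-! ### Forms linear in one block of variables, and the Jacobian dual matrices -/

section Jacobian

open MvPolynomial

/-- As `ψ` is additive, a monomial of weight d goes to a product of degree ψ(d). It serves to
compute the degrees of composites of forms, for one block of variables or two. -/
theorem isHomogeneous_aeval {k : Type*} [CommSemiring k] {σ τ M : Type*} [AddCommMonoid M]
    {w : σ → M} {p : MvPolynomial σ k} {d : M} (hp : IsWeightedHomogeneous w p d) (ψ : M →+ ℕ)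
    {g : σ → MvPolynomial τ k} (hg : ∀ i, (g i).IsHomogeneous (ψ (w i))) :
    (aeval g p).IsHomogeneous (ψ d) := by
  rw [p.as_sum, map_sum]
  refine IsHomogeneous.sum _ _ _ fun u hu => ?_
  have hw : Finsupp.weight w u = d := hp (mem_support_iff.1 hu)
  rw [aeval_monomial, algebraMap_eq]
  refine IsHomogeneous.C_mul ?_ _
  have h := IsHomogeneous.prod u.support (fun i => g i ^ u i) (fun i => ψ (w i) * u i)
    fun i _ => (hg i).pow (u i)
  convert! h using 1
  rw [← hw, Finsupp.weight_apply, Finsupp.sum, map_sum]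
  exact Finset.sum_congr rfl fun i _ => by rw [map_nsmul, smul_eq_mul, mul_comm]

variable {k : Type*} [Field k] {n m s : ℕ}

/-- The inclusion of the `z`-variables. -/
def zVar (l : Fin (s + 1)) : Fin (n + 1) ⊕ Fin (m + 1) ⊕ Fin (s + 1) := Sum.inr (Sum.inr l)

theorem zVar_injective : Function.Injective (zVar (n := n) (m := m) (s := s)) :=
  Sum.inr_injective.comp Sum.inr_injective

theorem toZ_rename_zVar (q : MvPolynomial (Fin (s + 1)) k) :
    toZ (rename (zVar (n := n) (m := m)) q) = q := by
  rw [toZ, aeval_rename]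
  exact aeval_X_left_apply q

theorem weight_triWeight_mapDomain (v : Fin (s + 1) →₀ ℕ) :
    Finsupp.weight (triWeight n m s) (v.mapDomain zVar) = (0, 0, v.degree) := by
  rw [Finsupp.weight_apply, Finsupp.sum_mapDomain_index_inj zVar_injective, Finsupp.degree]
  simp only [triWeight, zVar, Sum.elim_inr, Finsupp.sum]
  ext <;> simp [Prod.fst_sum, Prod.snd_sum]
  rfl

theorem isWeightedHomogeneous_rename_zVar {q : MvPolynomial (Fin (s + 1)) k} {d : ℕ}
    (hq : q.IsHomogeneous d) :
    IsWeightedHomogeneous (triWeight n m s) (rename zVar q) (0, 0, d) := by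
  rw [q.as_sum, map_sum]
  refine IsWeightedHomogeneous.sum _ _ _ fun v hv => ?_
  rw [rename_monomial]
  apply isWeightedHomogeneous_monomial
  rw [weight_triWeight_mapDomain]
  have : v.degree = d := by
    rw [← hq (mem_support_iff.1 hv), Finsupp.degree_eq_sum, Finsupp.weight_apply,
      Finsupp.sum_fintype _ _ (by simp)]
    simp
  rw [this]

/-- The variables `e i` are those of weight `δ`, and all forms of tridegree `δ + (0, 0, *)` are
linear in them, with coefficients in `k[z]`. -/
structure IsLinearBlock (n m s : ℕ) {N : ℕ}
    (e : Fin (N + 1) → Fin (n + 1) ⊕ Fin (m + 1) ⊕ Fin (s + 1)) (δ : ℕ × ℕ × ℕ) : Prop where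
  injective : Function.Injective e
  ne_zVar : ∀ i l, e i ≠ zVar l
  weight_eq : ∀ i, triWeight n m s (e i) = δ
  exists_eq : ∀ (u : Fin (n + 1) ⊕ Fin (m + 1) ⊕ Fin (s + 1) →₀ ℕ) (d : ℕ),
    Finsupp.weight (triWeight n m s) u = δ + (0, 0, d) →
      ∃ i v, u = Finsupp.single (e i) 1 + Finsupp.mapDomain zVar v ∧ v.degree = d

theorem weight_triWeight (u : Fin (n + 1) ⊕ Fin (m + 1) ⊕ Fin (s + 1) →₀ ℕ) :
    Finsupp.weight (triWeight n m s) u =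
      (∑ i, u (Sum.inl i), ∑ j, u (Sum.inr (Sum.inl j)), ∑ l, u (zVar l)) := by
  rw [Finsupp.weight_apply, Finsupp.sum_fintype _ _ (by simp), Fintype.sum_sum_type,
    Fintype.sum_sum_type]
  ext <;> simp [triWeight, Prod.fst_sum, Prod.snd_sum, zVar]

theorem exists_eq_one_of_sum_eq_one {ι : Type*} [Fintype ι] {a : ι → ℕ} (h : ∑ i, a i = 1) :
    ∃ i, a i = 1 ∧ ∀ j ≠ i, a j = 0 := by
  classical
  obtain ⟨i, -, hi⟩ := Finset.exists_ne_zero_of_sum_ne_zero (h.trans_ne one_ne_zero)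
  have h1 := Finset.add_sum_erase Finset.univ a (Finset.mem_univ i)
  refine ⟨i, by omega, fun j hj => ?_⟩
  have h2 : ∑ j ∈ Finset.univ.erase i, a j = 0 := by omega
  exact Finset.sum_eq_zero_iff.1 h2 j (by simp [hj])

theorem isLinearBlock_inl : IsLinearBlock n m s Sum.inl (1, 0, 0) where
  injective := Sum.inl_injective
  ne_zVar _ _ := Sum.inl_ne_inr
  weight_eq _ := rfl
  exists_eq u d h := by
    rw [weight_triWeight] at h
    simp only [Prod.mk_add_mk, Prod.mk.injEq, add_zero, zero_add] at h
    obtain ⟨h1, h2, h3⟩ := h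
    obtain ⟨i, hi, hi'⟩ := exists_eq_one_of_sum_eq_one h1
    refine ⟨i, Finsupp.equivFunOnFinite.symm fun l => u (zVar l), ?_, by
      rw [Finsupp.degree_eq_sum]; exact h3⟩
    ext (j | j | l)
    · rw [Finsupp.add_apply, Finsupp.mapDomain_of_notMem_range _ _ (by simp [zVar])]
      rcases eq_or_ne j i with rfl | hj
      · simp [hi]
      · simp [hi' j hj, hj.symm]
    · rw [Finsupp.add_apply, Finsupp.mapDomain_of_notMem_range _ _ (by simp [zVar])]
      simpa using Finset.sum_eq_zero_iff.1 h2 j (Finset.mem_univ j)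
    · have h := Finsupp.mapDomain_apply (zVar_injective (n := n) (m := m) (s := s))
        (Finsupp.equivFunOnFinite.symm fun l => u (zVar l)) l
      rw [Finsupp.add_apply, show Sum.inr (Sum.inr l) = zVar (n := n) (m := m) l from rfl, h]
      simp [zVar]

theorem isLinearBlock_inr_inl :
    IsLinearBlock n m s (fun j => Sum.inr (Sum.inl j)) (0, 1, 0) where
  injective := Sum.inr_injective.comp Sum.inl_injective
  ne_zVar _ _ := by simp [zVar]
  weight_eq _ := rfl
  exists_eq u d h := by
    rw [weight_triWeight] at h
    simp only [Prod.mk_add_mk, Prod.mk.injEq, add_zero, zero_add] at h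
    obtain ⟨h1, h2, h3⟩ := h
    obtain ⟨i, hi, hi'⟩ := exists_eq_one_of_sum_eq_one h2
    refine ⟨i, Finsupp.equivFunOnFinite.symm fun l => u (zVar l), ?_, by
      rw [Finsupp.degree_eq_sum]; exact h3⟩
    ext (j | j | l)
    · rw [Finsupp.add_apply, Finsupp.mapDomain_of_notMem_range _ _ (by simp [zVar])]
      simpa using Finset.sum_eq_zero_iff.1 h1 j (Finset.mem_univ j)
    · rw [Finsupp.add_apply, Finsupp.mapDomain_of_notMem_range _ _ (by simp [zVar])]
      rcases eq_or_ne j i with rfl | hj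
      · simp [hi]
      · simp [hi' j hj, hj.symm]
    · have h := Finsupp.mapDomain_apply (zVar_injective (n := n) (m := m) (s := s))
        (Finsupp.equivFunOnFinite.symm fun l => u (zVar l)) l
      rw [Finsupp.add_apply, show Sum.inr (Sum.inr l) = zVar (n := n) (m := m) l from rfl, h]
      simp [zVar]

namespace IsLinearBlock

variable {N : ℕ} {e : Fin (N + 1) → Fin (n + 1) ⊕ Fin (m + 1) ⊕ Fin (s + 1)} {δ : ℕ × ℕ × ℕ}

theorem toZ_X (he : IsLinearBlock n m s e δ) (i : Fin (N + 1)) :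
    toZ (X (e i) : PolyXYZ k n m s) = 0 := by
  have h := he.ne_zVar i
  rw [toZ, aeval_X]
  generalize e i = c at h ⊢
  rcases c with j | j | l
  · rfl
  · rfl
  · exact absurd rfl (h l)

theorem toZ_pderiv_rename_mul_X (he : IsLinearBlock n m s e δ) (i j : Fin (N + 1))
    (q : MvPolynomial (Fin (s + 1)) k) :
    toZ (pderiv (e i) (rename zVar q * X (e j) : PolyXYZ k n m s)) = if i = j then q else 0 := by
  rw [pderiv_mul, map_add, map_mul, map_mul, he.toZ_X, mul_zero, zero_add, toZ_rename_zVar]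
  split_ifs with h
  · rw [h, pderiv_X_self, map_one, mul_one]
  · rw [pderiv_X_of_ne fun h' => h (he.injective h').symm, map_zero, mul_zero]

/-- A form of tridegree `δ + (0, 0, d)` is recovered from its derivatives. -/
theorem eq_sum_and_isHomogeneous (he : IsLinearBlock n m s e δ) {p : PolyXYZ k n m s} {d : ℕ}
    (hp : IsWeightedHomogeneous (triWeight n m s) p (δ + (0, 0, d))) :
    p = ∑ i, rename zVar (toZ (pderiv (e i) p)) * X (e i) ∧
      ∀ i, (toZ (pderiv (e i) p)).IsHomogeneous d := by
  -- Each monomial contains exactly one block variable, to the first power, so both claims follow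
  -- monomial by monomial.
  have hmon : ∀ u ∈ p.support, ∃ i, ∃ q : MvPolynomial (Fin (s + 1)) k,
      monomial u (coeff u p) = rename zVar q * X (e i) ∧ q.IsHomogeneous d := by
    intro u hu
    obtain ⟨i, v, rfl, hv⟩ := he.exists_eq u d (hp (mem_support_iff.1 hu))
    refine ⟨i, monomial v (coeff (Finsupp.single (e i) 1 + Finsupp.mapDomain zVar v) p), ?_,
      isHomogeneous_monomial _ hv⟩
    rw [rename_monomial, X, monomial_mul, mul_one,
      add_comm (Finsupp.mapDomain zVar v)]
  constructor
  · have key : ∀ u ∈ p.support, monomial u (coeff u p) =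
        ∑ i, rename zVar (toZ (pderiv (e i) (monomial u (coeff u p)))) * X (e i) := by
      intro u hu
      obtain ⟨j, q, hq, -⟩ := hmon u hu
      rw [hq]
      simp only [he.toZ_pderiv_rename_mul_X]
      simp [apply_ite (rename _)]
    conv_lhs => rw [p.as_sum, Finset.sum_congr rfl key, Finset.sum_comm]
    refine Finset.sum_congr rfl fun i _ => ?_
    rw [← Finset.sum_mul, ← map_sum, ← map_sum, ← map_sum, ← p.as_sum]
  · intro i
    rw [p.as_sum, map_sum, map_sum]
    refine IsHomogeneous.sum _ _ _ fun u hu => ?_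
    obtain ⟨j, q, hq, hq'⟩ := hmon u hu
    rw [hq, he.toZ_pderiv_rename_mul_X]
    split_ifs
    · exact hq'
    · exact isHomogeneous_zero _ _ _

theorem isWeightedHomogeneous_sum (he : IsLinearBlock n m s e δ)
    {v : Fin (N + 1) → MvPolynomial (Fin (s + 1)) k} {d : ℕ} (hv : ∀ i, (v i).IsHomogeneous d) :
    IsWeightedHomogeneous (triWeight n m s)
      (∑ i, rename zVar (v i) * X (e i) : PolyXYZ k n m s) (δ + (0, 0, d)) := by
  refine IsWeightedHomogeneous.sum _ _ _ fun i _ => ?_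
  have h := (isWeightedHomogeneous_rename_zVar (n := n) (m := m) (hv i)).mul
    (isWeightedHomogeneous_X k (triWeight n m s) (e i))
  rwa [he.weight_eq i, add_comm (0, 0, d) δ] at h

end IsLinearBlock

/-! ### Linear forms in the Rees ideal as relations -/

section Rees

variable (V : ProjVariety k n) (W : ProjVariety k m) (f : Fin (s + 1) → PolyXY k n m)

theorem aeval_mk_X_inl (r : MvPolynomial (Fin (n + 1)) k) :
    aeval (fun i => Ideal.Quotient.mk (prodIdeal V W) (X (Sum.inl i))) r =
      Ideal.Quotient.mk (prodIdeal V W) (rename Sum.inl r) := by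
  have h : aeval (fun i => Ideal.Quotient.mk (prodIdeal V W) (X (Sum.inl i))) =
      (Ideal.Quotient.mkₐ k (prodIdeal V W)).comp (rename Sum.inl) := by
    ext i
    simp
  rw [h]
  rfl

theorem aeval_mk_X_inr (r : MvPolynomial (Fin (m + 1)) k) :
    aeval (fun i => Ideal.Quotient.mk (prodIdeal V W) (X (Sum.inr i))) r =
      Ideal.Quotient.mk (prodIdeal V W) (rename Sum.inr r) := by
  have h : aeval (fun i => Ideal.Quotient.mk (prodIdeal V W) (X (Sum.inr i))) =
      (Ideal.Quotient.mkₐ k (prodIdeal V W)).comp (rename Sum.inr) := by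
    ext i
    simp
  rw [h]
  rfl

/-- The classes of the polynomials `f l` in the coordinate ring of `V × W`. -/
def prodClass (l : Fin (s + 1)) : ProdRing V W := Ideal.Quotient.mk (prodIdeal V W) (f l)

theorem aeval_prodClass (q : MvPolynomial (Fin (s + 1)) k) :
    aeval (prodClass V W f) q = Ideal.Quotient.mk (prodIdeal V W) (aeval f q) := by
  change _ = Ideal.Quotient.mkₐ k _ _
  rw [← AlgHom.comp_apply, comp_aeval]
  rfl

theorem aeval_prodClass_eq_zero_iff {q : MvPolynomial (Fin (s + 1)) k} :
    aeval (prodClass V W f) q = 0 ↔ aeval f q ∈ prodIdeal V W := by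
  rw [aeval_prodClass, Ideal.Quotient.eq_zero_iff_mem]

theorem reesMap_rename_zVar {q : MvPolynomial (Fin (s + 1)) k} {d : ℕ} (hq : q.IsHomogeneous d) :
    reesMap V W f (rename zVar q) =
      Polynomial.C (aeval (prodClass V W f) q) * Polynomial.X ^ d := by
  have h : aeval (fun l => Polynomial.C (prodClass V W f l)) q =
      Polynomial.C (aeval (prodClass V W f) q) :=
    aeval_algebraMap_apply (Polynomial (ProdRing V W)) (prodClass V W f) q
  rw [reesMap, aeval_rename, ← h, ← aeval_mul_of_isHomogeneous hq]
  rfl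

theorem reesMap_sum {N : ℕ} {e : Fin (N + 1) → Fin (n + 1) ⊕ Fin (m + 1) ⊕ Fin (s + 1)}
    {ξ : Fin (N + 1) → ProdRing V W} (hξ : ∀ i, reesMap V W f (X (e i)) = Polynomial.C (ξ i))
    {v : Fin (N + 1) → MvPolynomial (Fin (s + 1)) k} {d : ℕ} (hv : ∀ i, (v i).IsHomogeneous d) :
    reesMap V W f (∑ i, rename zVar (v i) * X (e i)) =
      Polynomial.C (∑ i, aeval (prodClass V W f) (v i) * ξ i) * Polynomial.X ^ d := by
  rw [map_sum, map_sum, Finset.sum_mul]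
  refine Finset.sum_congr rfl fun i _ => ?_
  rw [map_mul, hξ, reesMap_rename_zVar V W f (hv i), map_mul]
  ring

/-- By `reesMap_sum`, a form linear in the block lies in the Rees ideal exactly when its
coefficients are a relation. An expression of such a form through the P_l becomes one of coefficient
vectors by differentiating and setting x = y = 0. -/
theorem isRelationMatrix_pderiv {N : ℕ}
    {e : Fin (N + 1) → Fin (n + 1) ⊕ Fin (m + 1) ⊕ Fin (s + 1)} {δ : ℕ × ℕ × ℕ}
    (he : IsLinearBlock n m s e δ) {ξ : Fin (N + 1) → ProdRing V W}
    (hξ : ∀ i, reesMap V W f (X (e i)) = Polynomial.C (ξ i)) {r : ℕ}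
    {P : Fin r → PolyXYZ k n m s}
    (hP : IsMinimalGenerators {p | p ∈ reesIdeal V W f ∧
      ∃ d : ℕ, IsWeightedHomogeneous (triWeight n m s) p (δ + (0, 0, d))} P) :
    IsRelationMatrix (prodClass V W f) ξ
      (Matrix.of fun l i => toZ (pderiv (e i) (P l))) where
  isHomogeneous l := by
    obtain ⟨-, d, hd⟩ := hP.mem l
    exact ⟨d, (he.eq_sum_and_isHomogeneous hd).2⟩
  sum_eq_zero l := by
    obtain ⟨h0, d, hd⟩ := hP.mem l
    obtain ⟨h1, h2⟩ := he.eq_sum_and_isHomogeneous hd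
    rw [reesIdeal, RingHom.mem_ker, h1, reesMap_sum V W f hξ h2] at h0
    have := congrArg (fun p => Polynomial.coeff p d) h0
    simpa only [Matrix.of_apply, Polynomial.coeff_C_mul_X_pow, if_true, Polynomial.coeff_zero]
      using this
  mem_span v d hv h0 := by
    have hmem : ∑ i, rename zVar (v i) * X (e i) ∈ Ideal.span (Set.range P) := by
      rw [hP.span_eq]
      refine Ideal.subset_span ⟨?_, d, he.isWeightedHomogeneous_sum hv⟩
      rw [reesIdeal, RingHom.mem_ker, reesMap_sum V W f hξ hv, h0, map_zero, zero_mul]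
    -- Thus the product rule leaves no terms with derivatives of the a_l.
    have hz : ∀ l, toZ (P l) = 0 := by
      intro l
      obtain ⟨-, d, hd⟩ := hP.mem l
      rw [(he.eq_sum_and_isHomogeneous hd).1, map_sum]
      exact Finset.sum_eq_zero fun i _ => by rw [map_mul, he.toZ_X, mul_zero]
    obtain ⟨a, ha⟩ := (Submodule.mem_span_range_iff_exists_fun _).1 hmem
    refine (Submodule.mem_span_range_iff_exists_fun _).2 ⟨fun l => toZ (a l), ?_⟩
    ext1 i
    have h1 := congrArg (fun p => toZ (pderiv (e i) p)) ha
    simp only [map_sum, smul_eq_mul, he.toZ_pderiv_rename_mul_X, Finset.sum_ite_eq,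
      Finset.mem_univ, if_true] at h1
    rw [← h1, Finset.sum_apply]
    refine Finset.sum_congr rfl fun l _ => ?_
    rw [pderiv_mul, map_add, map_mul, map_mul, hz, mul_zero, zero_add]
    rfl

end Rees

namespace BiRatMap

variable {V : ProjVariety k n} {W : ProjVariety k m} {T : ProjVariety k s}

theorem isRelationMatrix_xJacobian (F : BiRatMap V W T) {r : ℕ} {P : Fin r → PolyXYZ k n m s}
    (hP : IsMinimalGenerators F.xForms P) :
    IsRelationMatrix (prodClass V W F.f)
      (fun i => Ideal.Quotient.mk (prodIdeal V W) (X (Sum.inl i))) (xJacobian P) := by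
  refine isRelationMatrix_pderiv V W F.f isLinearBlock_inl (fun i => ?_) ?_
  · simp [reesMap]
  · simpa [xForms] using hP

theorem isRelationMatrix_yJacobian (F : BiRatMap V W T) {r : ℕ} {P : Fin r → PolyXYZ k n m s}
    (hP : IsMinimalGenerators F.yForms P) :
    IsRelationMatrix (prodClass V W F.f)
      (fun j => Ideal.Quotient.mk (prodIdeal V W) (X (Sum.inr j))) (yJacobian P) := by
  refine isRelationMatrix_pderiv V W F.f isLinearBlock_inr_inl (fun i => ?_) ?_
  · simp [reesMap]
  · simpa [yForms] using hP

/-- One inclusion is part of the data of `F`, and the image ideal is generated by forms. This is the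
shape in which dominance transfers identities from R to the coordinate ring of T. -/
theorem dominant_iff (F : BiRatMap V W T) : F.Dominant ↔
    ∀ (q : MvPolynomial (Fin (s + 1)) k) (d : ℕ), q.IsHomogeneous d →
      aeval (prodClass V W F.f) q = 0 → q ∈ T.ideal := by
  constructor
  · intro h q d hq h0
    rw [Dominant] at h
    rw [← h]
    exact Ideal.subset_span ⟨⟨d, hq⟩, (aeval_prodClass_eq_zero_iff V W F.f).1 h0⟩
  · intro h
    refine le_antisymm (Ideal.span_le.2 ?_) F.le_imageIdeal
    rintro q ⟨⟨d, hd⟩, hq⟩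
    exact h q d hd ((aeval_prodClass_eq_zero_iff V W F.f).2 hq)

end BiRatMap

/-! ### From proportional vectors to inverse maps -/

/-- A vector of forms proportional to the coordinates of the source maps `T` to `V`. -/
theorem aeval_mem_of_proportional {T : ProjVariety k s} {V : ProjVariety k n} {R : Type*}
    [CommRing R] [IsDomain R] [Algebra k R] {φ : Fin (s + 1) → R}
    (hT : ∀ (q : MvPolynomial (Fin (s + 1)) k) (d : ℕ), q.IsHomogeneous d → aeval φ q = 0 →
      q ∈ T.ideal) {ξ : Fin (n + 1) → R} (hξ : ∃ i, ξ i ≠ 0)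
    (hV : ∀ p ∈ V.ideal, aeval ξ p = 0) {g : Fin (n + 1) → MvPolynomial (Fin (s + 1)) k} {d : ℕ}
    (hg : ∀ i, (g i).IsHomogeneous d)
    (h : ∀ i j, aeval φ (g i) * ξ j = aeval φ (g j) * ξ i) {p : MvPolynomial (Fin (n + 1)) k}
    (hp : p ∈ V.ideal) : aeval g p ∈ T.ideal := by
  obtain ⟨j, hj⟩ := hξ
  rw [← sum_homogeneousComponent p, map_sum]
  refine Ideal.sum_mem _ fun c _ => ?_
  have hc := homogeneousComponent_isHomogeneous c p
  have hcV := V.isHomogeneous p hp c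
  refine hT _ (c * d) (isHomogeneous_aeval hc (AddMonoidHom.mulRight d) fun i => by
    simpa using hg i) ?_
  -- Evaluating the component p_c at g_i(φ) ξ_j = g_j(φ) ξ_i in two ways gives p_c(g(φ)) ξ_j^c =
  -- p_c(ξ) g_j(φ)^c = 0.
  have h1 := aeval_mul_of_isHomogeneous hc (fun i => aeval φ (g i)) (ξ j)
  have h2 := aeval_mul_of_isHomogeneous hc ξ (aeval φ (g j))
  simp only [h _ j, mul_comm (ξ _)] at h1 h2
  rw [h2, hV _ hcV, zero_mul] at h1
  have h3 : aeval φ (aeval g (homogeneousComponent c p)) =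
      aeval (fun i => aeval φ (g i)) (homogeneousComponent c p) := by
    rw [← AlgHom.comp_apply, comp_aeval]
  rw [h3]
  exact (mul_eq_zero.1 h1.symm).resolve_right (pow_ne_zero _ hj)

/-- Both sides are the value of p at the common vector (g_i ξ_a, h_j η_b) = (g_a ξ_i, h_b η_j). -/
theorem aeval_mul_of_proportional {R : Type*} [CommRing R] [Algebra k R] {p : PolyXY k n m}
    {c d : ℕ} (hp : IsWeightedHomogeneous (biWeight n m) p (c, d)) {g ξ : Fin (n + 1) → R}
    {h η : Fin (m + 1) → R} {a : Fin (n + 1)} {b : Fin (m + 1)}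
    (hg : ∀ i, g i * ξ a = g a * ξ i) (hh : ∀ j, h j * η b = h b * η j) :
    aeval (Sum.elim g h) p * (ξ a ^ c * η b ^ d) =
      aeval (Sum.elim ξ η) p * (g a ^ c * h b ^ d) := by
  rw [← aeval_mul_of_isBihomogeneous hp, ← aeval_mul_of_isBihomogeneous hp]
  simp only [hg, hh, mul_comm (ξ _), mul_comm (η _)]

/-- The hypotheses are already the identity for the composite on V × W. For the composite on T, the
pullback of F(g, h) to R is proportional to f, and dominance brings the cross relations back to T.
-/
theorem BiRatMap.isInverse_of_proportional [IsAlgClosed k] {V : ProjVariety k n}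
    {W : ProjVariety k m} {T : ProjVariety k s} {F : BiRatMap V W T} (hF : F.Dominant)
    (G : RatMap T V) (H : RatMap T W)
    (hG : ∀ i j, aeval (prodClass V W F.f) (G.g i) *
        Ideal.Quotient.mk (prodIdeal V W) (X (Sum.inl j)) =
      aeval (prodClass V W F.f) (G.g j) * Ideal.Quotient.mk (prodIdeal V W) (X (Sum.inl i)))
    (hH : ∀ i j, aeval (prodClass V W F.f) (H.g i) *
        Ideal.Quotient.mk (prodIdeal V W) (X (Sum.inr j)) =
      aeval (prodClass V W F.f) (H.g j) * Ideal.Quotient.mk (prodIdeal V W) (X (Sum.inr i))) :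
    F.IsInverse G H := by
  have hT := F.dominant_iff.1 hF
  obtain ⟨a, ha⟩ := exists_mk_X_inl_ne_zero V W
  obtain ⟨b, hb⟩ := exists_mk_X_inr_ne_zero V W
  obtain ⟨i, hi⟩ := G.exists_notMem
  obtain ⟨j, hj⟩ := H.exists_notMem
  have hi' : aeval (prodClass V W F.f) (G.g i) ≠ 0 := fun h => hi (hT _ _ (G.isHomogeneous i) h)
  have hj' : aeval (prodClass V W F.f) (H.g j) ≠ 0 := fun h => hj (hT _ _ (H.isHomogeneous j) h)
  set φ := prodClass V W F.f with hφ
  obtain ⟨c, d, hbi⟩ : ∃ c d, ∀ l, IsWeightedHomogeneous (biWeight n m) (F.f l) (c, d) :=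
    ⟨_, _, F.isBihomogeneous⟩
  have hcomp : ∀ l, aeval φ (aeval (Sum.elim G.g H.g) (F.f l)) *
      (Ideal.Quotient.mk (prodIdeal V W) (X (Sum.inl a)) ^ c *
        Ideal.Quotient.mk (prodIdeal V W) (X (Sum.inr b)) ^ d) =
      φ l * (aeval φ (G.g a) ^ c * aeval φ (H.g b) ^ d) := by
    intro l
    have h3 : aeval φ (aeval (Sum.elim G.g H.g) (F.f l)) =
        aeval (Sum.elim (fun i => aeval φ (G.g i)) fun i => aeval φ (H.g i)) (F.f l) := by
      rw [← AlgHom.comp_apply, comp_aeval]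
      congr 2
      ext i
      rcases i with i | i <;> rfl
    have h4 : aeval (Sum.elim (fun i => Ideal.Quotient.mk (prodIdeal V W) (X (Sum.inl i)))
        fun i => Ideal.Quotient.mk (prodIdeal V W) (X (Sum.inr i))) (F.f l) = φ l := by
      have : (aeval (Sum.elim (fun i => Ideal.Quotient.mk (prodIdeal V W) (X (Sum.inl i)))
          fun i => Ideal.Quotient.mk (prodIdeal V W) (X (Sum.inr i))) :
            PolyXY k n m →ₐ[k] ProdRing V W) = Ideal.Quotient.mkₐ k (prodIdeal V W) := by
        ext i
        rcases i with i | i <;> simp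
      rw [this]
      rfl
    rw [h3, ← h4]
    exact aeval_mul_of_proportional (hbi l) (g := fun i => aeval φ (G.g i))
      (ξ := fun i => Ideal.Quotient.mk (prodIdeal V W) (X (Sum.inl i)))
      (h := fun i => aeval φ (H.g i))
      (η := fun i => Ideal.Quotient.mk (prodIdeal V W) (X (Sum.inr i)))
      (fun i => hG i a) (fun i => hH i b)
  -- Here x_a ≠ 0 and g_i(φ) ≠ 0, while g_i(φ) x_a = g_a(φ) x_i.
  have hGa : aeval φ (G.g a) ≠ 0 := fun h => by
    have := hG i a
    rw [h, zero_mul] at this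
    exact mul_ne_zero hi' ha this
  have hHb : aeval φ (H.g b) ≠ 0 := fun h => by
    have := hH j b
    rw [h, zero_mul] at this
    exact mul_ne_zero hj' hb this
  have hab : Ideal.Quotient.mk (prodIdeal V W) (X (Sum.inl a)) ^ c *
        Ideal.Quotient.mk (prodIdeal V W) (X (Sum.inr b)) ^ d ≠ 0 :=
    mul_ne_zero (pow_ne_zero _ ha) (pow_ne_zero _ hb)
  have hhom : ∀ l, (aeval (Sum.elim G.g H.g) (F.f l)).IsHomogeneous
      (c * G.degree + d * H.degree) := fun l =>
    isHomogeneous_aeval (hbi l)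
      ((AddMonoidHom.mulRight G.degree).coprod (AddMonoidHom.mulRight H.degree)) (by
        rintro (i | i)
        · simpa [biWeight] using G.isHomogeneous i
        · simpa [biWeight] using H.isHomogeneous i)
  have hmem : ∀ q q' : PolyXY k n m, Ideal.Quotient.mk (prodIdeal V W) q =
      Ideal.Quotient.mk (prodIdeal V W) q' → q - q' ∈ prodIdeal V W := fun q q' =>
    Ideal.Quotient.eq.1
  have hne : ∀ q, aeval φ q ≠ 0 → aeval F.f q ∉ prodIdeal V W := fun q h h' =>
    h ((aeval_prodClass_eq_zero_iff V W F.f).2 h')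
  refine ⟨⟨i, hne _ hi'⟩, fun i j => hmem _ _ ?_, ⟨j, hne _ hj'⟩, fun i j => hmem _ _ ?_, ?_,
    fun l r => ?_⟩
  · simpa only [map_mul, hφ, aeval_prodClass] using hG i j
  · simpa only [map_mul, hφ, aeval_prodClass] using hH i j
  · obtain ⟨l, hl⟩ := F.exists_notMem
    refine ⟨l, fun h => hl ?_⟩
    -- Elements of I(T) vanish at φ because the image of F lies in T; `hcomp` would then force f_l =
    -- 0 in R.
    have h1 : aeval φ (aeval (Sum.elim G.g H.g) (F.f l)) = 0 := by
      rw [hφ, aeval_prodClass_eq_zero_iff]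
      have hle : imageIdeal V W F.f ≤ (prodIdeal V W).comap (aeval F.f) :=
        Ideal.span_le.2 fun q hq => hq.2
      exact hle (F.le_imageIdeal h)
    have h2 := hcomp l
    rw [h1, zero_mul] at h2
    have h3 := (mul_eq_zero.1 h2.symm).resolve_right
      (mul_ne_zero (pow_ne_zero _ hGa) (pow_ne_zero _ hHb))
    exact Ideal.Quotient.eq_zero_iff_mem.1 h3
  · refine hT _ (c * G.degree + d * H.degree + 1)
      (((hhom l).mul (isHomogeneous_X _ _)).sub ((hhom r).mul (isHomogeneous_X _ _))) ?_
    refine (mul_eq_zero.1 ?_).resolve_right hab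
    rw [map_sub, map_mul, map_mul, aeval_X, aeval_X]
    linear_combination φ r * hcomp l - φ l * hcomp r

end Jacobian

end JacobianDual

end

/-! ### The criterion and the formula for the inverse -/

theorem theorem2p2 {k : Type*} [Field k] [IsAlgClosed k] {n m s : ℕ}
    (X : JacobianDual.ProjVariety k n) (Y : JacobianDual.ProjVariety k m)
    (Z : JacobianDual.ProjVariety k s) (hX : X.Nondegenerate) (hY : Y.Nondegenerate)
    (F : JacobianDual.BiRatMap X Y Z)
    {p q : ℕ} (P : Fin p → JacobianDual.PolyXYZ k n m s)
    (hP : JacobianDual.IsMinimalGenerators F.xForms P)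
    (Q : Fin q → JacobianDual.PolyXYZ k n m s)
    (hQ : JacobianDual.IsMinimalGenerators F.yForms Q) :
    (F.IsBirational ↔
      JacobianDual.rankOver Z (JacobianDual.xJacobian P) = n ∧
        JacobianDual.rankOver Z (JacobianDual.yJacobian Q) = m) ∧
    (F.IsBirational →
      (∃ σ : Fin n ↪o Fin p,
        JacobianDual.rankOver Z ((JacobianDual.xJacobian P).submatrix σ id) = n) ∧
      (∃ τ : Fin m ↪o Fin q,
        JacobianDual.rankOver Z ((JacobianDual.yJacobian Q).submatrix τ id) = m) ∧
      ∀ (σ : Fin n ↪o Fin p) (τ : Fin m ↪o Fin q),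
        JacobianDual.rankOver Z ((JacobianDual.xJacobian P).submatrix σ id) = n →
        JacobianDual.rankOver Z ((JacobianDual.yJacobian Q).submatrix τ id) = m →
        ∃ (G : JacobianDual.RatMap Z X) (H : JacobianDual.RatMap Z Y),
          F.IsInverse G H ∧
          G.g = JacobianDual.signedMinors ((JacobianDual.xJacobian P).submatrix σ id) ∧
          H.g = JacobianDual.signedMinors ((JacobianDual.yJacobian Q).submatrix τ id)) := by
  have hMx := F.isRelationMatrix_xJacobian hP
  have hMy := F.isRelationMatrix_yJacobian hQ
  have hx := JacobianDual.exists_mk_X_inl_ne_zero X Y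
  have hy := JacobianDual.exists_mk_X_inr_ne_zero X Y
  have hrank : F.IsBirational →
      JacobianDual.rankOver Z (JacobianDual.xJacobian P) = n ∧
        JacobianDual.rankOver Z (JacobianDual.yJacobian Q) = m := by
    rintro ⟨hdom, G, H, hGH⟩
    have hT := F.dominant_iff.1 hdom
    refine ⟨hMx.rankOver_eq_of_inverse hx hT G.isHomogeneous G.exists_notMem fun i j => ?_,
      hMy.rankOver_eq_of_inverse hy hT H.isHomogeneous H.exists_notMem fun i j => ?_⟩
    · rw [JacobianDual.aeval_prodClass, JacobianDual.aeval_prodClass, ← map_mul, ← map_mul]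
      exact Ideal.Quotient.eq.2 (hGH.left_eq i j)
    · rw [JacobianDual.aeval_prodClass, JacobianDual.aeval_prodClass, ← map_mul, ← map_mul]
      exact Ideal.Quotient.eq.2 (hGH.left_eq' i j)
  -- Dominance suffices here, so this serves both the converse, where no inverse is known yet, and
  -- the formula for the inverse.
  have hinv : F.Dominant → ∀ (σ : Fin n ↪o Fin p) (τ : Fin m ↪o Fin q),
      JacobianDual.rankOver Z ((JacobianDual.xJacobian P).submatrix σ id) = n →
      JacobianDual.rankOver Z ((JacobianDual.yJacobian Q).submatrix τ id) = m →
      ∃ (G : JacobianDual.RatMap Z X) (H : JacobianDual.RatMap Z Y),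
        F.IsInverse G H ∧
        G.g = JacobianDual.signedMinors ((JacobianDual.xJacobian P).submatrix σ id) ∧
        H.g = JacobianDual.signedMinors ((JacobianDual.yJacobian Q).submatrix τ id) := by
    intro hdom σ τ hσ hτ
    have hT := F.dominant_iff.1 hdom
    obtain ⟨d, hd⟩ := hMx.signedMinors_isHomogeneous σ
    obtain ⟨d', hd'⟩ := hMy.signedMinors_isHomogeneous τ
    have hX' : ∀ r ∈ X.ideal, MvPolynomial.aeval (fun i =>
        Ideal.Quotient.mk (JacobianDual.prodIdeal X Y) (MvPolynomial.X (Sum.inl i))) r = 0 := by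
      intro r hr
      rw [JacobianDual.aeval_mk_X_inl]
      exact Ideal.Quotient.eq_zero_iff_mem.2 (Ideal.mem_sup_left (Ideal.mem_map_of_mem _ hr))
    have hY' : ∀ r ∈ Y.ideal, MvPolynomial.aeval (fun i =>
        Ideal.Quotient.mk (JacobianDual.prodIdeal X Y) (MvPolynomial.X (Sum.inr i))) r = 0 := by
      intro r hr
      rw [JacobianDual.aeval_mk_X_inr]
      exact Ideal.Quotient.eq_zero_iff_mem.2 (Ideal.mem_sup_right (Ideal.mem_map_of_mem _ hr))
    let G : JacobianDual.RatMap Z X := ⟨_, d, hd, JacobianDual.exists_signedMinors_notMem hσ,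
      fun _ => JacobianDual.aeval_mem_of_proportional hT hx hX' hd (hMx.signedMinors_mul_eq hx σ)⟩
    let H : JacobianDual.RatMap Z Y := ⟨_, d', hd', JacobianDual.exists_signedMinors_notMem hτ,
      fun _ => JacobianDual.aeval_mem_of_proportional hT hy hY' hd' (hMy.signedMinors_mul_eq hy τ)⟩
    exact ⟨G, H, JacobianDual.BiRatMap.isInverse_of_proportional hdom G H
      (hMx.signedMinors_mul_eq hx σ) (hMy.signedMinors_mul_eq hy τ), rfl, rfl⟩
  refine ⟨⟨hrank, fun h => ?_⟩, fun h => ?_⟩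
  -- The rank of Ψ_x alone already forces dominance.
  · have hdom : F.Dominant := F.dominant_iff.2 fun r d hr h0 =>
      hMx.mem_ideal_of_rankOver h.1 hr h0
    obtain ⟨σ, hσ⟩ := JacobianDual.exists_rankOver_submatrix h.1
    obtain ⟨τ, hτ⟩ := JacobianDual.exists_rankOver_submatrix h.2
    obtain ⟨G, H, hGH, -⟩ := hinv hdom σ τ hσ hτ
    exact ⟨hdom, G, H, hGH⟩
  · exact ⟨JacobianDual.exists_rankOver_submatrix (hrank h).1,
      JacobianDual.exists_rankOver_submatrix (hrank h).2, hinv h.1⟩
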